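/- Let $N\ge 1$ and let $D\subseteq\mathbb R^N$ be open. For $u:D\to[-\infty,+\infty)$ write $u^+=\max\{u,0\}$ and, for $M\ge 0$, $u_M=\max\{u,-M\}+M$. For a real $K\ge 1$, $u$ is called *$K$-quasi-nearly subharmonic* in $D$ if $u$ is Lebesgue measurable, $u^+\in\mathcal L^1_{\mathrm{loc}}(D)$, and $$u_M(x)\le \frac{K}{\nu_N r^N}\int_{B^N(x,r)}u_M(y)\,dm_N(y)$$ for every closed Euclidean ball $\overline{B^N(x,r)}\subset D$ with $r>0$ and every $M\ge 0$, where $m_N$ is Lebesgue measure and $\nu_N=m_N(B^N(0,1))$. It is called *quasi-nearly subharmonic* in $D$ if it is $K$-quasi-nearly subharmonic in $D$ for some $K\ge 1$. **Corollary 4.5.** Let $m\ge n\ge 2$ be integers, let $\Omega$ be a domain (a nonempty connected open set) in $\mathbb R^{m+n}=\mathbb R^m\times\mathbb R^n$, and let $K\ge 1$. Let $u:\Omega\to[-\infty,+\infty)$ be a Lebesgue measurable function such that the following conditions hold. (a) For each $y\in\mathbb R^n$ the function $x\mapsto u(x,y)$ is $K$-quasi-nearly subharmonic in the open set $\Omega(y)=\{x\in\mathbb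 R^m:(x,y)\in\Omega\}$. (b) For each $x\in\mathbb R^m$ the function $y\mapsto u(x,y)$ is $K$-quasi-nearly subharmonic in the open set $\Omega(x)=\{y\in\mathbb R^n:(x,y)\in\Omega\}$. (c) There is a strictly increasing surjection $\varphi:[0,+\infty)\to[0,+\infty)$ such that (c1) $\displaystyle\int_{s_0+1}^{+\infty}\frac{s^{(n-1)/(m-1)}}{\varphi(s-s_0)^{1/(m-1)}}\,ds<+\infty$ for some $s_0\in\mathbb N$, and (c2) $\varphi\bigl(\log(1+(u^+)^r)\bigr)\in\mathcal L^1_{\mathrm{loc}}(\Omega)$ for some $r>0$. Then $u$ is quasi-nearly subharmonic in $\Omega$. -/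

import Mathlib

open MeasureTheory Set

/-- The point `(x, y)` of `ℝ^{m+n}`, for `x ∈ ℝ^m` and `y ∈ ℝ^n`. -/
def euclPair {m n : ℕ} (x : EuclideanSpace ℝ (Fin m)) (y : EuclideanSpace ℝ (Fin n)) :
    EuclideanSpace ℝ (Fin (m + n)) :=
  WithLp.toLp 2 (Fin.append x.ofLp y.ofLp)

/-- The positive part `u⁺ = max {u, 0}` of an extended real `u < +∞`, as a real number. -/
noncomputable def posPartReal (u : EReal) : ℝ :=
  (max u 0).toReal

/-- The shifted truncation `u_M = max {u, -M} + M` of an extended real `u < +∞`, as a real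
number. -/
noncomputable def truncShift (M : ℝ) (u : EReal) : ℝ :=
  (max u ((-M : ℝ) : EReal)).toReal + M

/-- `u : D → [-∞, +∞)` is `K`-quasi-nearly subharmonic in the open set `D ⊆ ℝ^N`. Functions on
`D` are represented by functions on the whole space; only their values on `D` matter.
For extended real valued functions, `NullMeasurable` with respect to the restriction of Lebesgue
measure to `D` is Lebesgue measurability on `D`. -/
structure IsQuasiNearlySubharmonicWith {N : ℕ} (K : ℝ) (D : Set (EuclideanSpace ℝ (Fin N)))
    (u : EuclideanSpace ℝ (Fin N) → EReal) : Prop where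
  one_le : 1 ≤ K
  lt_top : ∀ x ∈ D, u x < ⊤
  nullMeasurable : NullMeasurable u (volume.restrict D)
  locallyIntegrableOn_posPart : LocallyIntegrableOn (fun x => posPartReal (u x)) D volume
  mean_value : ∀ (x : EuclideanSpace ℝ (Fin N)) (r : ℝ), 0 < r → Metric.closedBall x r ⊆ D →
    ∀ M : ℝ, 0 ≤ M →
      truncShift M (u x) ≤
        K / (volume.real (Metric.ball (0 : EuclideanSpace ℝ (Fin N)) 1) * r ^ N) *
          ∫ y in Metric.ball x r, truncShift M (u y)

/-- `u` is quasi-nearly subharmonic in `D`: it is `K`-quasi-nearly subharmonic for some `K ≥ 1`. -/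
def IsQuasiNearlySubharmonic {N : ℕ} (D : Set (EuclideanSpace ℝ (Fin N)))
    (u : EuclideanSpace ℝ (Fin N) → EReal) : Prop :=
  ∃ K : ℝ, IsQuasiNearlySubharmonicWith K D u

/-! Applying the mean value inequality of `u_M` in x, then in y, and then Tonelli bounds `u_M` by
its mean over a ball of `ℝ^(m+n)`, with a constant independent of `M`. All that is missing is local
integrability of `v = u⁺`, and local boundedness of `v` supplies it.

Boundedness comes from Domar's method. Let `lam ≥ 2K`. If `v` exceeds `T lam^(k+1)` at the centre of
a ball and stays below `T lam^(k+2)` on it, then the volume of the ball is at most `lam²` times the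
measure of `{T lam^k < v ≤ T lam^(k+2)}`. On a larger ball some point has a higher level, and the
argument restarts there. Summing radii and applying Hölder with weights `f i` gives `r^(N+1) ≲ (∑_{i
≥ k} f i)^N ∫ g` whenever `g ≥ f i^(-N)` where `v > T lam^i`.

Write `q = n - 1`, `p = m - 1`. Domar in y with `f i = φ(i+2)^(-1/q)` and `g = φ(log(1+v^r))` bounds
the y-integral of `g` below by a multiple of `F j^(-q)` at every x' with `v(x',y)` above level `j`,
where `F` denotes the tails of `f`. Domar in x with that integral as the new `g` needs weights
proportional to `F^(q/p)`. They are summable by a Hardy inequality, valid as `q/p ≤ 1` (that is, `n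
≤ m`), and (c1) is exactly its hypothesis. High values of `v` then contradict (c2). -/

/-! ### Sequences: tails of antitone weights and the integral test -/

theorem rpow_add_sub_le_of_le {a : ℝ} (ha0 : 0 ≤ a) (ha1 : a ≤ 1) {s t h : ℝ} (ht : 0 ≤ t)
    (hts : t ≤ s) (hh : 0 ≤ h) : (s + h) ^ a - s ^ a ≤ (t + h) ^ a - t ^ a := by
  rcases eq_or_lt_of_le hts with rfl | hlt
  · exact le_rfl
  have hpos : 0 < s - t + h := by linarith
  have hc := Real.concaveOn_rpow ha0 ha1
  have hsh : s + h ∈ Ici (0 : ℝ) := by simp only [mem_Ici]; linarith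
  -- Both `t + h` and `s` are convex combinations of `t` and `s + h`, with interchanged weights; the
  -- two concavity inequalities add up to the claim.
  have h1 := @hc.2 t ht (s + h) hsh ((s - t) / (s - t + h)) (h / (s - t + h))
    (div_nonneg (by linarith) hpos.le) (div_nonneg hh hpos.le) (by field_simp)
  have h2 := @hc.2 t ht (s + h) hsh (h / (s - t + h)) ((s - t) / (s - t + h))
    (div_nonneg hh hpos.le) (div_nonneg (by linarith) hpos.le) (by field_simp; ring)
  have e1 : ((s - t) / (s - t + h)) • t + (h / (s - t + h)) • (s + h) = t + h := by
    simp only [smul_eq_mul]; field_simp; ring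
  have e2 : (h / (s - t + h)) • t + ((s - t) / (s - t + h)) • (s + h) = s := by
    simp only [smul_eq_mul]; field_simp; ring
  rw [e1] at h1
  rw [e2] at h2
  have e3 : (s - t) / (s - t + h) + h / (s - t + h) = 1 := by field_simp
  simp only [smul_eq_mul] at h1 h2
  have e4 : (s - t) / (s - t + h) = 1 - h / (s - t + h) := by linarith
  rw [e4] at h1 h2
  nlinarith

/-- The embedding of the Lorentz sequence space `ℓ^{1,a}` into `ℓ^1` for `a ≤ 1`. -/
theorem sum_rpow_le_sum_mul_rpow {a : ℝ} (ha0 : 0 < a) (ha1 : a ≤ 1) {f : ℕ → ℝ}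
    (hf : Antitone f) (hf0 : ∀ i, 0 ≤ f i) (d : ℕ) :
    (∑ i ∈ Finset.range d, f i) ^ a ≤
      ∑ i ∈ Finset.range d, (((i : ℝ) + 1) ^ a - (i : ℝ) ^ a) * f i ^ a := by
  induction d with
  | zero => simp [Real.zero_rpow ha0.ne']
  | succ d ih =>
    rw [Finset.sum_range_succ, Finset.sum_range_succ]
    have hle : (d : ℝ) * f d ≤ ∑ i ∈ Finset.range d, f i := by
      have := Finset.card_nsmul_le_sum (Finset.range d) f (f d)
        (fun i hi => hf (Finset.mem_range.1 hi).le)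
      simpa using this
    -- The partial sum is at least `d * f d`, so adding `f d` raises its power by no more than it
    -- raises that of `d * f d`.
    have hinc := rpow_add_sub_le_of_le ha0.le ha1
      (mul_nonneg (Nat.cast_nonneg d) (hf0 d)) hle (hf0 d)
    have e : ((d : ℝ) * f d + f d) = ((d : ℝ) + 1) * f d := by ring
    rw [e, Real.mul_rpow (by positivity) (hf0 d), Real.mul_rpow (by positivity) (hf0 d)] at hinc
    linarith [sub_mul (((d : ℝ) + 1) ^ a) ((d : ℝ) ^ a) (f d ^ a)]

theorem rpow_succ_sub_nonneg {a : ℝ} (ha0 : 0 < a) (i : ℕ) :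
    0 ≤ ((i : ℝ) + 1) ^ a - (i : ℝ) ^ a :=
  sub_nonneg.2 (Real.rpow_le_rpow (by positivity) (by linarith) ha0.le)

theorem tsum_ofReal_rpow_le {a : ℝ} (ha0 : 0 < a) (ha1 : a ≤ 1) {f : ℕ → ℝ}
    (hf : Antitone f) (hf0 : ∀ i, 0 ≤ f i) :
    (∑' i, ENNReal.ofReal (f i)) ^ a ≤
      ∑' i : ℕ, ENNReal.ofReal ((((i : ℝ) + 1) ^ a - (i : ℝ) ^ a) * f i ^ a) := by
  have hlim := (ENNReal.tendsto_nat_tsum fun i => ENNReal.ofReal (f i)).ennrpow_const a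
  refine le_of_tendsto' hlim fun d => ?_
  refine le_trans ?_ (ENNReal.sum_le_tsum (Finset.range d))
  rw [← ENNReal.ofReal_sum_of_nonneg (fun i _ => hf0 i),
    ← ENNReal.ofReal_sum_of_nonneg
      (fun i _ => mul_nonneg (rpow_succ_sub_nonneg ha0 i) (Real.rpow_nonneg (hf0 i) a)),
    ENNReal.ofReal_rpow_of_nonneg (Finset.sum_nonneg fun i _ => hf0 i) ha0.le]
  exact ENNReal.ofReal_le_ofReal (sum_rpow_le_sum_mul_rpow ha0 ha1 hf hf0 d)

/-- A Hardy type inequality for the tails of an antitone sequence. -/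
theorem tsum_tail_rpow_le {a : ℝ} (ha0 : 0 < a) (ha1 : a ≤ 1) {f : ℕ → ℝ}
    (hf : Antitone f) (hf0 : ∀ i, 0 ≤ f i) :
    ∑' k, (∑' i, ENNReal.ofReal (f (k + i))) ^ a ≤
      ∑' j : ℕ, ENNReal.ofReal (((j : ℝ) + 1) ^ a * f j ^ a) := by
  calc ∑' k, (∑' i, ENNReal.ofReal (f (k + i))) ^ a
      ≤ ∑' k, ∑' i : ℕ, ENNReal.ofReal ((((i : ℝ) + 1) ^ a - (i : ℝ) ^ a) * f (k + i) ^ a) := by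
        refine ENNReal.tsum_le_tsum fun k => ?_
        exact tsum_ofReal_rpow_le ha0 ha1 (f := fun i => f (k + i))
          (fun i j hij => hf (by omega)) (fun i => hf0 _)
    _ = ∑' p : ℕ × ℕ,
          ENNReal.ofReal ((((p.2 : ℝ) + 1) ^ a - (p.2 : ℝ) ^ a) * f (p.1 + p.2) ^ a) :=
        (ENNReal.tsum_prod (f := fun k i : ℕ =>
          ENNReal.ofReal ((((i : ℝ) + 1) ^ a - (i : ℝ) ^ a) * f (k + i) ^ a))).symm
    _ = ∑' j : ℕ, ENNReal.ofReal (((j : ℝ) + 1) ^ a * f j ^ a) := by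
        -- Along an antidiagonal `k + i = j` the factor `f (k + i)` is constant and the coefficients
        -- telescope to `(j + 1) ^ a`.
        rw [← Finset.HasAntidiagonal.sigmaAntidiagonalEquivProd.tsum_eq, ENNReal.tsum_sigma']
        refine tsum_congr fun j => ?_
        simp only [Finset.HasAntidiagonal.sigmaAntidiagonalEquivProd_apply]
        rw [tsum_fintype, Finset.sum_coe_sort (Finset.HasAntidiagonal.antidiagonal j) (fun p : ℕ × ℕ =>
          ENNReal.ofReal ((((p.2 : ℝ) + 1) ^ a - (p.2 : ℝ) ^ a) * f (p.1 + p.2) ^ a)),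
          ← ENNReal.ofReal_sum_of_nonneg
            (fun p _ => mul_nonneg (rpow_succ_sub_nonneg ha0 p.2) (Real.rpow_nonneg (hf0 _) a))]
        congr 1
        rw [Finset.sum_congr rfl (g := fun p : ℕ × ℕ =>
          (((p.2 : ℝ) + 1) ^ a - (p.2 : ℝ) ^ a) * f j ^ a)
          (fun p hp => by rw [Finset.HasAntidiagonal.mem_antidiagonal.1 hp]), ← Finset.sum_mul,
          ← Finset.Nat.sum_antidiagonal_swap, Finset.Nat.sum_antidiagonal_eq_sum_range_succ_mk]
        have := Finset.sum_range_sub (fun i : ℕ => (i : ℝ) ^ a) (j + 1)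
        simp only [Nat.cast_add, Nat.cast_one, Nat.cast_zero, Real.zero_rpow ha0.ne', sub_zero]
          at this
        simp only [Prod.snd_swap, this]

/-- Summability of the tails, under the hypothesis of the Hardy type inequality. -/
theorem summable_tail_rpow {a : ℝ} (ha0 : 0 < a) (ha1 : a ≤ 1) {f : ℕ → ℝ}
    (hf : Antitone f) (hf0 : ∀ i, 0 ≤ f i)
    (hs : Summable fun j : ℕ => ((j : ℝ) + 1) ^ a * f j ^ a) :
    Summable f ∧ Summable fun k => (∑' i, f (k + i)) ^ a := by
  have hle := tsum_tail_rpow_le ha0 ha1 hf hf0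
  have hfin : ∑' k, (∑' i, ENNReal.ofReal (f (k + i))) ^ a ≠ ⊤ :=
    ne_top_of_le_ne_top hs.tsum_ofReal_ne_top hle
  have h0 : ∑' i, ENNReal.ofReal (f i) ≠ ⊤ := by
    have := ENNReal.ne_top_of_tsum_ne_top hfin 0
    simp only [zero_add] at this
    intro h
    rw [h, ENNReal.top_rpow_of_pos ha0] at this
    exact this rfl
  have hsum : Summable f := by
    have := ENNReal.summable_toReal h0
    simpa only [ENNReal.toReal_ofReal (hf0 _)] using this
  refine ⟨hsum, ?_⟩
  have := ENNReal.summable_toReal hfin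
  refine this.congr fun k => ?_
  rw [← ENNReal.ofReal_tsum_of_nonneg (fun i => hf0 _)
    (by simpa only [add_comm] using (summable_nat_add_iff k).2 hsum),
    ← ENNReal.toReal_rpow, ENNReal.toReal_ofReal (tsum_nonneg fun i => hf0 _)]

/-- Integral test: on the unit interval from `s₀ + 1 + i` one has `s ≥ i + 1` and `φ (s - s₀) ≤ φ (i
+ 2)`, so the integrand dominates the `i`-th term. -/
theorem summable_of_integrableOn_weight {φ : ℝ → ℝ} (hmono : StrictMonoOn φ (Ici 0))
    (hmaps : MapsTo φ (Ici 0) (Ici 0)) {a b : ℝ} (ha : 0 ≤ a) (hb : 0 ≤ b) {s₀ : ℕ}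
    (hint : IntegrableOn (fun s : ℝ => s ^ a / φ (s - (s₀ : ℝ)) ^ b) (Ioi ((s₀ : ℝ) + 1)) volume) :
    Summable fun i : ℕ => ((i : ℝ) + 1) ^ a / φ ((i : ℝ) + 2) ^ b := by
  have hφ0 : ∀ t : ℝ, 0 < t → 0 < φ t := fun t ht =>
    lt_of_le_of_lt (hmaps (mem_Ici.2 le_rfl)) (hmono (mem_Ici.2 le_rfl) (mem_Ici.2 ht.le) ht)
  set F : ℝ → ℝ := fun s => s ^ a / φ (s - (s₀ : ℝ)) ^ b with hF
  have hFnn : ∀ s ∈ Ioi ((s₀ : ℝ) + 1), 0 ≤ F s := fun s hs => by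
    have : (s₀ : ℝ) + 1 < s := hs
    have h0 : (0 : ℝ) ≤ s₀ := Nat.cast_nonneg _
    have := hφ0 (s - s₀) (by linarith)
    have : 0 ≤ s := by linarith
    simp only [hF]
    positivity
  set I : ℕ → Set ℝ := fun i => Ioc ((s₀ : ℝ) + 1 + i) ((s₀ : ℝ) + 1 + (i + 1 : ℕ)) with hI
  have hIsub : ∀ i, I i ⊆ Ioi ((s₀ : ℝ) + 1) := fun i s hs => by
    have : (s₀ : ℝ) + 1 + i < s := hs.1
    have h0 : (0 : ℝ) ≤ i := Nat.cast_nonneg _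
    exact mem_Ioi.2 (by linarith)
  have hdisj : Pairwise (Function.onFun Disjoint I) := by
    have hmon : Monotone fun i : ℕ => (s₀ : ℝ) + 1 + i := fun i j hij => by
      have : (i : ℝ) ≤ j := by exact_mod_cast hij
      simp only; linarith
    exact hmon.pairwise_disjoint_on_Ioc_succ
  have hsum : Summable fun i => ∫ s in I i, F s :=
    (hasSum_integral_iUnion (fun i => measurableSet_Ioc) hdisj
      (hint.mono_set (iUnion_subset hIsub))).summable
  refine Summable.of_nonneg_of_le (fun i => ?_) (fun i => ?_) hsum
  · have := hφ0 ((i : ℝ) + 2) (by positivity)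
    positivity
  · have hvol : volume.real (I i) = 1 := by
      rw [hI]; simp [Measure.real]
    have hφi := hφ0 ((i : ℝ) + 2) (by positivity)
    have := setIntegral_mono_on (μ := volume) (s := I i)
      (f := fun _ => ((i : ℝ) + 1) ^ a / φ ((i : ℝ) + 2) ^ b) (g := F)
      (integrableOn_const (by simp [hI])) (hint.mono_set (hIsub i)) measurableSet_Ioc
      (fun s hs => by
        have h1 : (s₀ : ℝ) + 1 + i < s := hs.1
        have h2 : s ≤ (s₀ : ℝ) + 1 + (i + 1 : ℕ) := hs.2
        push_cast at h2
        have h0 : (0 : ℝ) ≤ s₀ := Nat.cast_nonneg _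
        have hi0 : (0 : ℝ) ≤ i := Nat.cast_nonneg _
        have hpos := hφ0 (s - s₀) (by linarith)
        have hle : φ (s - s₀) ≤ φ ((i : ℝ) + 2) :=
          hmono.monotoneOn (mem_Ici.2 (by linarith)) (mem_Ici.2 (by linarith)) (by linarith)
        have hs0 : 0 ≤ s := by linarith
        simp only [hF]
        gcongr
        linarith)
    simpa [hvol] using this

/-! ### Domar's method for one mean value inequality -/

/-- The volume of the unit ball of `ℝ^N`. -/
noncomputable def unitBallVolume (N : ℕ) : ℝ :=
  volume.real (Metric.ball (0 : EuclideanSpace ℝ (Fin N)) 1)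

theorem unitBallVolume_pos (N : ℕ) : 0 < unitBallVolume N :=
  ENNReal.toReal_pos (Metric.measure_ball_pos _ _ one_pos).ne' measure_ball_lt_top.ne

theorem volume_real_ball_eq {N : ℕ} (x : EuclideanSpace ℝ (Fin N)) {r : ℝ} (hr : 0 < r) :
    volume.real (Metric.ball x r) = unitBallVolume N * r ^ N := by
  rw [Measure.real, Measure.addHaar_ball_of_pos _ _ hr, finrank_euclideanSpace_fin, ENNReal.toReal_mul,
    ENNReal.toReal_ofReal (by positivity), mul_comm]
  rfl

/-- The mean value inequality with constant `K` on all closed balls contained in `D`. -/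
def HasMeanValueBound {N : ℕ} (K : ℝ) (D : Set (EuclideanSpace ℝ (Fin N)))
    (w : EuclideanSpace ℝ (Fin N) → ℝ) : Prop :=
  ∀ (x : EuclideanSpace ℝ (Fin N)) (r : ℝ), 0 < r → Metric.closedBall x r ⊆ D →
    w x ≤ K / (unitBallVolume N * r ^ N) * ∫ y in Metric.ball x r, w y

/-- This qualitative bound only serves to make Domar's chain stop. -/
theorem HasMeanValueBound.bddAbove_closedBall {N : ℕ} {K : ℝ} (hK : 0 ≤ K)
    {D : Set (EuclideanSpace ℝ (Fin N))} {w : EuclideanSpace ℝ (Fin N) → ℝ}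
    (hw : HasMeanValueBound K D w) (hw0 : ∀ z, 0 ≤ w z) (hint : LocallyIntegrableOn w D volume)
    {y : EuclideanSpace ℝ (Fin N)} {r : ℝ} (hr : 0 < r) (hD : Metric.closedBall y (2 * r) ⊆ D) :
    ∃ B, ∀ z ∈ Metric.closedBall y r, w z ≤ B := by
  refine ⟨K / (unitBallVolume N * r ^ N) * ∫ z in Metric.closedBall y (2 * r), w z,
    fun z hz => ?_⟩
  have hsub : Metric.closedBall z r ⊆ Metric.closedBall y (2 * r) :=
    Metric.closedBall_subset_closedBall' (by
      have := Metric.mem_closedBall.1 hz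
      linarith)
  refine (hw z r hr (hsub.trans hD)).trans ?_
  have hν := unitBallVolume_pos N
  refine mul_le_mul_of_nonneg_left ?_ (by positivity)
  exact setIntegral_mono_set (hint.integrableOn_compact_subset hD (isCompact_closedBall _ _))
    (Filter.Eventually.of_forall hw0)
    (Filter.Eventually.of_forall (Metric.ball_subset_closedBall.trans hsub))

/-- Values up to `T * lam ^ k` contribute at most half of `T * lam ^ (k + 1)` to the right side,
because `K ≤ lam / 2`; the rest must come from the level set. -/
theorem HasMeanValueBound.mul_pow_le_of_bounded {N : ℕ} {K lam T : ℝ} (hK : 1 ≤ K)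
    (hlam : 2 * K ≤ lam) (hT : 0 < T) {D S : Set (EuclideanSpace ℝ (Fin N))}
    {w : EuclideanSpace ℝ (Fin N) → ℝ} (hw : HasMeanValueBound K D w) (hw0 : ∀ z, 0 ≤ w z)
    (hmeas : AEMeasurable w (volume.restrict S)) (hS : volume S ≠ ⊤) (hSD : S ⊆ D)
    {k : ℕ} {y : EuclideanSpace ℝ (Fin N)} {r : ℝ} (hr : 0 < r) (hsub : Metric.closedBall y r ⊆ S)
    (hy : T * lam ^ (k + 1) < w y) (hbd : ∀ z ∈ Metric.ball y r, w z ≤ T * lam ^ (k + 2)) :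
    unitBallVolume N * r ^ N ≤
      lam ^ 2 * (volume.restrict S).real (w ⁻¹' Ioc (T * lam ^ k) (T * lam ^ (k + 2))) := by
  have hlam0 : 0 < lam := by linarith
  have hν := unitBallVolume_pos N
  set E := w ⁻¹' Ioc (T * lam ^ k) (T * lam ^ (k + 2)) with hE
  have hrest : volume.restrict (Metric.ball y r) ≤ volume.restrict S :=
    Measure.restrict_mono (Metric.ball_subset_closedBall.trans hsub) le_rfl
  have hfin : IsFiniteMeasure (volume.restrict S) := ⟨by simpa using hS.lt_top⟩
  have hfin' : IsFiniteMeasure (volume.restrict (Metric.ball y r)) :=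
    ⟨by simpa using measure_ball_lt_top⟩
  have hEm : NullMeasurableSet E (volume.restrict (Metric.ball y r)) :=
    (hmeas.mono_measure hrest).nullMeasurable measurableSet_Ioc
  have hint : ∫ z in Metric.ball y r, w z ≤
      T * lam ^ k * (unitBallVolume N * r ^ N) +
        T * lam ^ (k + 2) * (volume.restrict S).real E := by
    have h1 : ∫ z in Metric.ball y r, w z ≤
        ∫ z in Metric.ball y r, (T * lam ^ k + E.indicator (fun _ => T * lam ^ (k + 2)) z) := by
      refine integral_mono_of_nonneg (Filter.Eventually.of_forall hw0) ?_ ?_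
      · exact (integrable_const _).add ((integrable_const _).indicator₀ hEm)
      · filter_upwards [ae_restrict_mem measurableSet_ball] with z hz
        by_cases hzE : z ∈ E
        · rw [indicator_of_mem hzE]
          have := hbd z hz
          have : 0 ≤ T * lam ^ k := by positivity
          linarith
        · rw [indicator_of_notMem hzE, add_zero]
          by_contra hcon
          exact hzE ⟨not_le.1 hcon, hbd z hz⟩
    refine h1.trans ?_
    rw [integral_add (integrable_const _) ((integrable_const _).indicator₀ hEm),
      integral_indicator₀ hEm, integral_const, integral_const]
    simp only [smul_eq_mul, measureReal_restrict_apply_univ]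
    rw [volume_real_ball_eq y hr]
    have : (volume.restrict (Metric.ball y r)).real E ≤ (volume.restrict S).real E :=
      ENNReal.toReal_mono (measure_ne_top _ _) (hrest E)
    have h2 : 0 ≤ T * lam ^ (k + 2) := by positivity
    nlinarith
  have hmv := hw y r hr (hsub.trans hSD)
  set V := unitBallVolume N * r ^ N with hV
  have hVpos : 0 < V := by positivity
  set e := (volume.restrict S).real E with he
  have he0 : 0 ≤ e := measureReal_nonneg
  have h3 : T * lam ^ (k + 1) * V ≤ K * (T * lam ^ k * V + T * lam ^ (k + 2) * e) := by
    have h4 : w y * V ≤ K * ∫ z in Metric.ball y r, w z := by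
      have := mul_le_mul_of_nonneg_right hmv hVpos.le
      rwa [div_mul_eq_mul_div, div_mul_cancel₀ _ hVpos.ne'] at this
    nlinarith
  have hP : 0 < T * lam ^ k := by positivity
  have h5 : lam * V ≤ K * (V + lam ^ 2 * e) := by
    refine le_of_mul_le_mul_left ?_ hP
    calc T * lam ^ k * (lam * V) = T * lam ^ (k + 1) * V := by ring
      _ ≤ _ := h3
      _ = _ := by ring
  have h6 : K * (V + lam ^ 2 * e) ≤ lam / 2 * (V + lam ^ 2 * e) :=
    mul_le_mul_of_nonneg_right (by linarith) (by positivity)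
  have h7 : lam * V ≤ lam * (lam ^ 2 * e) := by nlinarith
  exact le_of_mul_le_mul_left h7 hlam0

/-- Domar's chain argument: a point of level above `k` can be surrounded by a ball inside the
region of boundedness only if its radius is at most the sum of the radii attached to the
levels. -/
theorem HasMeanValueBound.radius_le_sum {N : ℕ} {K lam T : ℝ} (hK : 1 ≤ K)
    (hlam : 2 * K ≤ lam) (hT : 0 < T) {D S : Set (EuclideanSpace ℝ (Fin N))}
    {w : EuclideanSpace ℝ (Fin N) → ℝ} (hw : HasMeanValueBound K D w) (hw0 : ∀ z, 0 ≤ w z)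
    (hmeas : AEMeasurable w (volume.restrict S)) (hS : volume S ≠ ⊤) (hSD : S ⊆ D)
    {ρ : ℕ → ℝ} (hρ0 : ∀ i, 0 ≤ ρ i) (hρ : ∀ i, unitBallVolume N * ρ i ^ N =
      lam ^ 2 * (volume.restrict S).real (w ⁻¹' Ioc (T * lam ^ i) (T * lam ^ (i + 2))))
    (hN : N ≠ 0)
    (d k : ℕ) {y : EuclideanSpace ℝ (Fin N)} {r : ℝ} (hr : 0 ≤ r)
    (hsub : Metric.closedBall y r ⊆ S)
    (hy : T * lam ^ (k + 1) < w y) (hbd : ∀ z ∈ S, w z ≤ T * lam ^ (k + 1 + d)) :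
    r ≤ ∑ i ∈ Finset.range d, ρ (k + i) := by
  induction d generalizing k y r with
  | zero => exact absurd (hbd y (hsub (Metric.mem_closedBall_self hr))) (not_le.2 hy)
  | succ d ih =>
    by_contra hcon
    rw [not_le, Finset.sum_range_succ'] at hcon
    simp only [add_zero] at hcon
    set σ := ∑ i ∈ Finset.range d, ρ (k + (i + 1)) with hσ
    have hσ0 : 0 ≤ σ := Finset.sum_nonneg fun i _ => hρ0 _
    have hpos : 0 < r - σ := by linarith [hρ0 k]
    -- Since `r - σ > ρ k`, this ball is too large for level `k + 2` to bound `w` on it. A point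
    -- above that level keeps a surrounding radius greater than `σ`, against the induction
    -- hypothesis.
    have hnb : ¬ ∀ z ∈ Metric.ball y (r - σ), w z ≤ T * lam ^ (k + 2) := fun hb => by
      have := hw.mul_pow_le_of_bounded hK hlam hT hw0 hmeas hS hSD hpos
        ((Metric.closedBall_subset_closedBall (by linarith)).trans hsub) hy hb
      rw [← hρ k] at this
      have h1 := le_of_mul_le_mul_left this (unitBallVolume_pos N)
      have h2 := pow_lt_pow_left₀ (show ρ k < r - σ by linarith) (hρ0 k) hN
      linarith
    push Not at hnb
    obtain ⟨z, hz, hwz⟩ := hnb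
    have hd : dist z y < r - σ := Metric.mem_ball.1 hz
    have := ih (k + 1) (y := z) (r := r - dist z y) (by linarith)
      ((Metric.closedBall_subset_closedBall' (by linarith)).trans hsub) hwz
      (fun z hz => by
        have := hbd z hz
        rwa [show k + 1 + (d + 1) = k + 1 + 1 + d by ring] at this)
    have e : ∑ i ∈ Finset.range d, ρ (k + 1 + i) = σ :=
      Finset.sum_congr rfl fun i _ => by rw [show k + 1 + i = k + (i + 1) by ring]
    rw [e] at this
    linarith

/-- Hölder's inequality, obtained from Jensen with weights `f i / F` at the points `ρ i / f i`. -/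
theorem sum_pow_le_mul_sum_div (N : ℕ) {ι : Type*} (s : Finset ι) {f ρ : ι → ℝ}
    (hf : ∀ i, 0 < f i) (hρ : ∀ i, 0 ≤ ρ i) :
    (∑ i ∈ s, ρ i) ^ (N + 1) ≤ (∑ i ∈ s, f i) ^ N * ∑ i ∈ s, ρ i ^ (N + 1) / f i ^ N := by
  rcases s.eq_empty_or_nonempty with rfl | hs
  · simp
  set F := ∑ i ∈ s, f i with hF
  have hFpos : 0 < F := Finset.sum_pos (fun i _ => hf i) hs
  have := Real.pow_arith_mean_le_arith_mean_pow s (fun i => f i / F) (fun i => ρ i / f i)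
    (fun i _ => by have := hf i; positivity) (by rw [← Finset.sum_div, div_self hFpos.ne'])
    (fun i _ => div_nonneg (hρ i) (hf i).le) (N + 1)
  have e1 : ∑ i ∈ s, f i / F * (ρ i / f i) = (∑ i ∈ s, ρ i) / F := by
    rw [Finset.sum_div]
    exact Finset.sum_congr rfl fun i _ => by have := (hf i).ne'; field_simp
  have e2 : ∑ i ∈ s, f i / F * (ρ i / f i) ^ (N + 1) =
      (∑ i ∈ s, ρ i ^ (N + 1) / f i ^ N) / F := by
    rw [Finset.sum_div]
    exact Finset.sum_congr rfl fun i _ => by have := (hf i).ne'; rw [div_pow]; field_simp; ring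
  rw [e1, e2, div_pow, div_le_div_iff₀ (by positivity) hFpos] at this
  refine le_of_mul_le_mul_right (this.trans (le_of_eq ?_)) hFpos
  ring

/-- Each window spans two consecutive levels, so a point lies in at most two of them; hence the
factor 2. -/
theorem sum_mul_measure_levels_le {α : Type*} [MeasurableSpace α] {μ : Measure α}
    {w : α → ℝ} (hw : AEMeasurable w μ) {T lam : ℝ} (hT : 0 < T) (hlam : 1 < lam)
    {g : α → ENNReal} {c : ℕ → ENNReal} (hg : ∀ᵐ z ∂μ, ∀ i : ℕ, T * lam ^ i < w z → c i ≤ g z)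
    (s : Finset ℕ) :
    ∑ i ∈ s, c i * μ (w ⁻¹' Ioc (T * lam ^ i) (T * lam ^ (i + 2))) ≤ 2 * ∫⁻ z, g z ∂μ := by
  classical
  set E : ℕ → Set α := fun i => w ⁻¹' Ioc (T * lam ^ i) (T * lam ^ (i + 2)) with hE
  have hEm : ∀ i, NullMeasurableSet (E i) μ := fun i => hw.nullMeasurable measurableSet_Ioc
  calc ∑ i ∈ s, c i * μ (E i) = ∑ i ∈ s, ∫⁻ z, (E i).indicator (fun _ => c i) z ∂μ :=
        Finset.sum_congr rfl fun i _ => (lintegral_indicator_const₀ (hEm i) _).symm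
    _ = ∫⁻ z, ∑ i ∈ s, (E i).indicator (fun _ => c i) z ∂μ :=
        (lintegral_finsetSum' _ fun i _ => aemeasurable_const.indicator₀ (hEm i)).symm
    _ ≤ ∫⁻ z, 2 * g z ∂μ := by
        refine lintegral_mono_ae ?_
        filter_upwards [hg] with z hz
        have h1 : ∑ i ∈ s, (E i).indicator (fun _ => c i) z =
            ∑ i ∈ s with z ∈ E i, c i := by
          rw [Finset.sum_filter]
          exact Finset.sum_congr rfl fun i _ => by simp [indicator_apply]
        rw [h1]
        have hcard : (s.filter fun i => z ∈ E i).card ≤ 2 := by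
          rcases (s.filter fun i => z ∈ E i).eq_empty_or_nonempty with h | h
          · simp [h]
          obtain ⟨i₀, hi₀, hmin⟩ := Finset.exists_min_image _ id h
          have hsub : (s.filter fun i => z ∈ E i) ⊆ {i₀, i₀ + 1} := fun i hi => by
            have hle : i₀ ≤ i := hmin i hi
            have ha : T * lam ^ i < w z := (Finset.mem_filter.1 hi).2.1
            have hb : w z ≤ T * lam ^ (i₀ + 2) := (Finset.mem_filter.1 hi₀).2.2
            have hlt : lam ^ i < lam ^ (i₀ + 2) :=
              lt_of_mul_lt_mul_left (ha.trans_le hb) hT.le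
            have := (pow_lt_pow_iff_right₀ hlam).1 hlt
            simp only [Finset.mem_insert, Finset.mem_singleton]
            omega
          exact (Finset.card_le_card hsub).trans Finset.card_le_two
        calc ∑ i ∈ s with z ∈ E i, c i ≤ (s.filter fun i => z ∈ E i).card • g z :=
              Finset.sum_le_card_nsmul _ _ _ fun i hi => hz i (Finset.mem_filter.1 hi).2.1
          _ ≤ 2 * g z := by
              rw [nsmul_eq_mul]
              gcongr
              exact_mod_cast hcard
    _ ≤ 2 * ∫⁻ z, g z ∂μ := (lintegral_const_mul' _ _ (by simp)).le

/-- A quantitative form of Domar's theorem. -/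
theorem HasMeanValueBound.ofReal_le_mul_lintegral {N : ℕ} {K lam T : ℝ} (hK : 1 ≤ K)
    (hlam : 2 * K ≤ lam) (hT : 0 < T) {D : Set (EuclideanSpace ℝ (Fin (N + 1)))}
    {w : EuclideanSpace ℝ (Fin (N + 1)) → ℝ} (hw : HasMeanValueBound K D w) (hw0 : ∀ z, 0 ≤ w z)
    (hint : LocallyIntegrableOn w D volume)
    {y : EuclideanSpace ℝ (Fin (N + 1))} {r : ℝ} (hr : 0 < r)
    (hD : Metric.closedBall y (2 * r) ⊆ D)
    {f : ℕ → ℝ} (hf : ∀ i, 0 < f i) (hfs : Summable f)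
    {g : EuclideanSpace ℝ (Fin (N + 1)) → ENNReal}
    (hg : ∀ z ∈ Metric.closedBall y r, ∀ i : ℕ, T * lam ^ i < w z →
      ENNReal.ofReal (f i ^ N)⁻¹ ≤ g z)
    {k : ℕ} (hy : T * lam ^ (k + 1) < w y) :
    ENNReal.ofReal (unitBallVolume (N + 1) * r ^ (N + 1)) ≤
      ENNReal.ofReal (2 * lam ^ 2 * (∑' i, f (k + i)) ^ N) *
        ∫⁻ z in Metric.closedBall y r, g z := by
  have hν := unitBallVolume_pos (N + 1)
  have hlam1 : 1 < lam := by linarith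
  set S := Metric.closedBall y r with hSdef
  have hSD : S ⊆ D := (Metric.closedBall_subset_closedBall (by linarith)).trans hD
  have hS : volume S ≠ ⊤ := measure_closedBall_lt_top.ne
  have hfin : IsFiniteMeasure (volume.restrict S) := ⟨by simpa using hS.lt_top⟩
  have hmeas : AEMeasurable w (volume.restrict S) :=
    (hint.integrableOn_compact_subset hSD (isCompact_closedBall _ _)).aemeasurable
  obtain ⟨B, hB⟩ := hw.bddAbove_closedBall (by linarith) hw0 hint hr hD
  -- The chain length `d` depends on `B`, but disappears once the partial sums are replaced by full
  -- tails.
  obtain ⟨d, hd⟩ := pow_unbounded_of_one_lt (B / T) hlam1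
  set e : ℕ → ℝ := fun i =>
    (volume.restrict S).real (w ⁻¹' Ioc (T * lam ^ i) (T * lam ^ (i + 2))) with he
  have he0 : ∀ i, 0 ≤ e i := fun i => measureReal_nonneg
  set ρ : ℕ → ℝ := fun i => (lam ^ 2 * e i / unitBallVolume (N + 1)) ^ ((N + 1 : ℕ) : ℝ)⁻¹ with hρ
  have hρ0 : ∀ i, 0 ≤ ρ i := fun i => by have := he0 i; positivity
  have hρe : ∀ i, unitBallVolume (N + 1) * ρ i ^ (N + 1) = lam ^ 2 * e i := fun i => by
    have := he0 i
    rw [hρ]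
    simp only
    rw [Real.rpow_inv_natCast_pow (by positivity) (by omega)]
    field_simp
  have hrle : r ≤ ∑ i ∈ Finset.range d, ρ (k + i) :=
    hw.radius_le_sum hK hlam hT hw0 hmeas hS hSD hρ0 hρe (by omega) d k hr.le subset_rfl hy
      (fun z hz => by
        have h1 := hB z hz
        have h2 : B < T * lam ^ d := by
          rw [div_lt_iff₀ hT] at hd
          linarith
        have h3 : lam ^ d ≤ lam ^ (k + 1 + d) := pow_le_pow_right₀ hlam1.le (by omega)
        nlinarith)
  have hsumf : ∑ i ∈ Finset.range d, f (k + i) ≤ ∑' i, f (k + i) :=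
    Summable.sum_le_tsum _ (fun i _ => (hf _).le)
      (by simpa only [add_comm] using (summable_nat_add_iff k).2 hfs)
  have hmain : unitBallVolume (N + 1) * r ^ (N + 1) ≤
      lam ^ 2 * (∑' i, f (k + i)) ^ N *
        ∑ i ∈ Finset.range d, (f (k + i) ^ N)⁻¹ * e (k + i) := by
    have h1 := pow_le_pow_left₀ hr.le hrle (N + 1)
    have h2 := sum_pow_le_mul_sum_div N (Finset.range d) (f := fun i => f (k + i))
      (ρ := fun i => ρ (k + i)) (fun i => hf _) (fun i => hρ0 _)
    calc unitBallVolume (N + 1) * r ^ (N + 1)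
        ≤ unitBallVolume (N + 1) * ((∑ i ∈ Finset.range d, f (k + i)) ^ N *
          ∑ i ∈ Finset.range d, ρ (k + i) ^ (N + 1) / f (k + i) ^ N) :=
          mul_le_mul_of_nonneg_left (h1.trans h2) hν.le
      _ = (∑ i ∈ Finset.range d, f (k + i)) ^ N *
          ∑ i ∈ Finset.range d, lam ^ 2 * ((f (k + i) ^ N)⁻¹ * e (k + i)) := by
          rw [mul_left_comm, Finset.mul_sum]
          congr 1
          refine Finset.sum_congr rfl fun i _ => ?_
          rw [← mul_div_assoc, hρe]
          ring
      _ = lam ^ 2 * (∑ i ∈ Finset.range d, f (k + i)) ^ N *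
          ∑ i ∈ Finset.range d, (f (k + i) ^ N)⁻¹ * e (k + i) := by
          rw [← Finset.mul_sum]; ring
      _ ≤ _ := by
          refine mul_le_mul_of_nonneg_right ?_ (Finset.sum_nonneg fun i _ => by
            have := hf (k + i); have := he0 (k + i); positivity)
          have : 0 ≤ ∑ i ∈ Finset.range d, f (k + i) := Finset.sum_nonneg fun i _ => (hf _).le
          gcongr
  have hlev := sum_mul_measure_levels_le (μ := volume.restrict S) hmeas hT hlam1
    (g := g) (c := fun i => ENNReal.ofReal (f i ^ N)⁻¹)
    ((ae_restrict_mem Metric.isClosed_closedBall.measurableSet).mono fun z hz i hi => hg z hz i hi)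
    ((Finset.range d).image fun i => k + i)
  rw [Finset.sum_image (fun i _ j _ h => by simpa using h)] at hlev
  have hsum : ENNReal.ofReal (∑ i ∈ Finset.range d, (f (k + i) ^ N)⁻¹ * e (k + i)) ≤
      2 * ∫⁻ z in S, g z := by
    refine le_trans (le_of_eq ?_) hlev
    rw [ENNReal.ofReal_sum_of_nonneg (fun i _ => by
      have := hf (k + i); have := he0 (k + i); positivity)]
    refine Finset.sum_congr rfl fun i _ => ?_
    rw [ENNReal.ofReal_mul (by have := hf (k + i); positivity), he, ofReal_measureReal]
  have hF0 : 0 ≤ ∑' i, f (k + i) := tsum_nonneg fun i => (hf _).le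
  calc ENNReal.ofReal (unitBallVolume (N + 1) * r ^ (N + 1))
      ≤ ENNReal.ofReal (lam ^ 2 * (∑' i, f (k + i)) ^ N *
        ∑ i ∈ Finset.range d, (f (k + i) ^ N)⁻¹ * e (k + i)) := ENNReal.ofReal_le_ofReal hmain
    _ = ENNReal.ofReal (lam ^ 2 * (∑' i, f (k + i)) ^ N) *
        ENNReal.ofReal (∑ i ∈ Finset.range d, (f (k + i) ^ N)⁻¹ * e (k + i)) :=
        ENNReal.ofReal_mul (by positivity)
    _ ≤ ENNReal.ofReal (lam ^ 2 * (∑' i, f (k + i)) ^ N) * (2 * ∫⁻ z in S, g z) := by gcongr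
    _ = _ := by
        rw [mul_assoc 2, ENNReal.ofReal_mul zero_le_two, ENNReal.ofReal_ofNat]
        ring

/-! ### Product structure, truncations and Tonelli -/

theorem measurePreserving_euclPair (m n : ℕ) :
    MeasurePreserving (fun p : EuclideanSpace ℝ (Fin m) × EuclideanSpace ℝ (Fin n) =>
      euclPair p.1 p.2) (volume.prod volume) volume := by
  have h1 := PiLp.volume_preserving_toLp (Fin (m + n))
  have h2 := volume_measurePreserving_sumPiEquivProdPi_symm (fun _ : Fin m ⊕ Fin n => ℝ)
  have h3 := volume_measurePreserving_piCongrLeft (fun _ : Fin (m + n) => ℝ) finSumFinEquiv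
  have h4 := (PiLp.volume_preserving_ofLp (Fin m)).prod (PiLp.volume_preserving_ofLp (Fin n))
  have key : (fun p : EuclideanSpace ℝ (Fin m) × EuclideanSpace ℝ (Fin n) => euclPair p.1 p.2) =
      WithLp.toLp 2 ∘ (MeasurableEquiv.piCongrLeft (fun _ : Fin (m + n) => ℝ) finSumFinEquiv) ∘
        (MeasurableEquiv.sumPiEquivProdPi fun _ : Fin m ⊕ Fin n => ℝ).symm ∘
          Prod.map WithLp.ofLp WithLp.ofLp := by
    funext p
    ext i
    obtain ⟨j, rfl⟩ := finSumFinEquiv.surjective i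
    simp only [Function.comp_apply, MeasurableEquiv.coe_piCongrLeft]
    rw [Equiv.piCongrLeft_apply_apply]
    rcases j with j | j
    · simp [euclPair, MeasurableEquiv.sumPiEquivProdPi]
    · simp [euclPair, MeasurableEquiv.sumPiEquivProdPi]
  rw [key]
  exact h1.comp (h3.comp (h2.comp h4))

theorem dist_euclPair {m n : ℕ} (x x' : EuclideanSpace ℝ (Fin m))
    (y y' : EuclideanSpace ℝ (Fin n)) :
    dist (euclPair x y) (euclPair x' y') = √(dist x x' ^ 2 + dist y y' ^ 2) := by
  rw [EuclideanSpace.dist_eq, EuclideanSpace.dist_eq, EuclideanSpace.dist_eq,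
    Real.sq_sqrt (Finset.sum_nonneg fun _ _ => sq_nonneg _),
    Real.sq_sqrt (Finset.sum_nonneg fun _ _ => sq_nonneg _), Fin.sum_univ_add]
  simp [euclPair]

theorem dist_euclPair_le {m n : ℕ} (x x' : EuclideanSpace ℝ (Fin m))
    (y y' : EuclideanSpace ℝ (Fin n)) :
    dist (euclPair x y) (euclPair x' y') ≤ dist x x' + dist y y' := by
  rw [dist_euclPair]
  refine Real.sqrt_le_iff.2 ⟨by positivity, ?_⟩
  nlinarith [dist_nonneg (x := x) (y := x'), dist_nonneg (x := y) (y := y')]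

theorem exists_euclPair_eq {m n : ℕ} (z : EuclideanSpace ℝ (Fin (m + n))) :
    ∃ x : EuclideanSpace ℝ (Fin m), ∃ y : EuclideanSpace ℝ (Fin n), euclPair x y = z := by
  refine ⟨WithLp.toLp 2 fun i => z (Fin.castAdd n i), WithLp.toLp 2 fun i => z (Fin.natAdd m i), ?_⟩
  ext i
  refine Fin.addCases (fun i => ?_) (fun i => ?_) i <;> simp [euclPair]

theorem prod_subset_preimage_euclPair {m n : ℕ} {x : EuclideanSpace ℝ (Fin m)}
    {y : EuclideanSpace ℝ (Fin n)} {r : ℝ} :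
    Metric.closedBall x r ×ˢ Metric.closedBall y r ⊆
      (fun p : EuclideanSpace ℝ (Fin m) × EuclideanSpace ℝ (Fin n) => euclPair p.1 p.2) ⁻¹'
        Metric.closedBall (euclPair x y) (2 * r) := by
  rintro ⟨x', y'⟩ ⟨hx, hy⟩
  have h1 := Metric.mem_closedBall.1 hx
  have h2 := Metric.mem_closedBall.1 hy
  have h3 := dist_euclPair_le x' x y' y
  exact Metric.mem_closedBall.2 (by simp only at *; linarith)

theorem posPartReal_nonneg (a : EReal) : 0 ≤ posPartReal a :=
  EReal.toReal_nonneg (le_max_right _ _)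

theorem truncShift_zero (a : EReal) : truncShift 0 a = posPartReal a := by
  simp [truncShift, posPartReal]

theorem truncShift_nonneg {M : ℝ} (hM : 0 ≤ M) (a : EReal) : 0 ≤ truncShift M a := by
  rw [truncShift]
  by_cases ha : a = ⊤
  · simpa [ha] using hM
  have hne : max a ((-M : ℝ) : EReal) ≠ ⊤ :=
    (max_lt (lt_top_iff_ne_top.2 ha) (EReal.coe_lt_top _)).ne
  have := EReal.toReal_le_toReal (le_max_right a ((-M : ℝ) : EReal)) (EReal.coe_ne_bot _) hne
  rw [EReal.toReal_coe] at this
  linarith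

theorem truncShift_le {M : ℝ} (hM : 0 ≤ M) (a : EReal) : truncShift M a ≤ posPartReal a + M := by
  rw [truncShift, posPartReal]
  by_cases ha : a = ⊤
  · simp [ha]
  have hne : max a 0 ≠ ⊤ := (max_lt (lt_top_iff_ne_top.2 ha) EReal.zero_lt_top).ne
  have hle : max a ((-M : ℝ) : EReal) ≤ max a 0 :=
    max_le_max le_rfl (by exact_mod_cast neg_nonpos.2 hM)
  have hbot : max a ((-M : ℝ) : EReal) ≠ ⊥ :=
    ((EReal.bot_lt_coe _).trans_le (le_max_right _ _)).ne'
  have := EReal.toReal_le_toReal hle hbot hne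
  linarith

theorem measurable_posPartReal : Measurable posPartReal :=
  measurable_ereal_toReal.comp (measurable_id.max measurable_const)

theorem measurable_truncShift (M : ℝ) : Measurable (truncShift M) :=
  (measurable_ereal_toReal.comp (measurable_id.max measurable_const)).add_const M

theorem lintegral_lintegral_euclPair_le {m n : ℕ} {h : EuclideanSpace ℝ (Fin (m + n)) → ENNReal}
    {S : Set (EuclideanSpace ℝ (Fin (m + n)))} (hS : MeasurableSet S)
    (hm : AEMeasurable h (volume.restrict S)) {A : Set (EuclideanSpace ℝ (Fin m))}
    {B : Set (EuclideanSpace ℝ (Fin n))}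
    (hAB : A ×ˢ B ⊆ (fun p : EuclideanSpace ℝ (Fin m) × EuclideanSpace ℝ (Fin n) =>
      euclPair p.1 p.2) ⁻¹' S) :
    ∫⁻ x in A, ∫⁻ y in B, h (euclPair x y) ≤ ∫⁻ z in S, h z := by
  have hmp := (measurePreserving_euclPair m n).restrict_preimage hS
  have hcomp := hm.comp_quasiMeasurePreserving hmp.quasiMeasurePreserving
  have hle := Measure.restrict_mono hAB
    (le_refl ((volume : Measure (EuclideanSpace ℝ (Fin m))).prod
      (volume : Measure (EuclideanSpace ℝ (Fin n)))))
  have h1 := lintegral_prod (μ := volume.restrict A) (ν := volume.restrict B)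
    (fun p : EuclideanSpace ℝ (Fin m) × EuclideanSpace ℝ (Fin n) => h (euclPair p.1 p.2))
    (by rw [Measure.prod_restrict]; exact hcomp.mono_measure hle)
  rw [← h1, Measure.prod_restrict]
  refine (lintegral_mono' hle le_rfl).trans (le_of_eq ?_)
  rw [← hmp.map_eq, lintegral_map' (by rwa [hmp.map_eq]) hmp.aemeasurable]

theorem IsQuasiNearlySubharmonicWith.hasMeanValueBound {N : ℕ} {K : ℝ}
    {D : Set (EuclideanSpace ℝ (Fin N))} {u : EuclideanSpace ℝ (Fin N) → EReal}
    (h : IsQuasiNearlySubharmonicWith K D u) :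
    HasMeanValueBound K D fun x => posPartReal (u x) := fun x r hr hD => by
  simpa only [truncShift_zero, unitBallVolume] using h.mean_value x r hr hD 0 le_rfl

/-- The form with lower integrals can be iterated without any integrability on the ball. -/
theorem HasMeanValueBound.ofReal_le_lintegral {N : ℕ} {K : ℝ} (hK : 0 ≤ K)
    {D : Set (EuclideanSpace ℝ (Fin N))} {w : EuclideanSpace ℝ (Fin N) → ℝ}
    (hw : HasMeanValueBound K D w) (hw0 : ∀ z, 0 ≤ w z)
    {x : EuclideanSpace ℝ (Fin N)} {r : ℝ} (hr : 0 < r) (hD : Metric.closedBall x r ⊆ D) :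
    ENNReal.ofReal (w x) ≤ ENNReal.ofReal (K / (unitBallVolume N * r ^ N)) *
      ∫⁻ y in Metric.ball x r, ENNReal.ofReal (w y) := by
  have hν := unitBallVolume_pos N
  refine (ENNReal.ofReal_le_ofReal (hw x r hr hD)).trans ?_
  rw [ENNReal.ofReal_mul (by positivity)]
  gcongr
  have := enorm_integral_le_lintegral_enorm (μ := volume.restrict (Metric.ball x r)) w
  rw [Real.enorm_of_nonneg (integral_nonneg hw0)] at this
  simpa only [Real.enorm_of_nonneg (hw0 _)] using this

/-! ### Local boundedness: Domar's estimate in y, then in x -/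

theorem exists_ball_bound_of_separately {p q : ℕ} (hq : 1 ≤ q) (hqp : q ≤ p) {K : ℝ} (hK : 1 ≤ K)
    {Ω : Set (EuclideanSpace ℝ (Fin (p + 1 + (q + 1))))} (hΩo : IsOpen Ω)
    {v : EuclideanSpace ℝ (Fin (p + 1 + (q + 1))) → ℝ} (hv0 : ∀ z, 0 ≤ v z)
    (ha : ∀ y, HasMeanValueBound K {x | euclPair x y ∈ Ω} fun x => v (euclPair x y))
    (ha' : ∀ y, LocallyIntegrableOn (fun x => v (euclPair x y)) {x | euclPair x y ∈ Ω} volume)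
    (hb : ∀ x, HasMeanValueBound K {y | euclPair x y ∈ Ω} fun y => v (euclPair x y))
    (hb' : ∀ x, LocallyIntegrableOn (fun y => v (euclPair x y)) {y | euclPair x y ∈ Ω} volume)
    {φ : ℝ → ℝ} (hmono : StrictMonoOn φ (Ici 0)) (hmaps : MapsTo φ (Ici 0) (Ici 0))
    (hs : Summable fun i : ℕ => ((i : ℝ) + 1) ^ ((q : ℝ) / p) / φ ((i : ℝ) + 2) ^ (1 / (p : ℝ)))
    {r : ℝ} (hr : 0 < r)
    (hint : LocallyIntegrableOn (fun z => φ (Real.log (1 + v z ^ r))) Ω volume)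
    {z₀ : EuclideanSpace ℝ (Fin (p + 1 + (q + 1)))} (hz₀ : z₀ ∈ Ω) :
    ∃ δ > 0, ∃ B, ∀ z ∈ Metric.ball z₀ δ, v z ≤ B := by
  obtain ⟨R, hR, hRΩ⟩ := Metric.nhds_basis_closedBall.mem_iff.1 (hΩo.mem_nhds hz₀)
  -- Points within `2 * δ` in each factor of a point of the `δ`-ball stay within `5 * δ < R` of
  -- `z₀`.
  set δ := R / 8 with hδ
  have hδ0 : 0 < δ := by positivity
  set S := Metric.closedBall z₀ R with hS
  have hIS := hint.integrableOn_compact_subset hRΩ (isCompact_closedBall _ _)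
  set gg : EuclideanSpace ℝ (Fin (p + 1 + (q + 1))) → ENNReal :=
    fun z => ENNReal.ofReal (φ (Real.log (1 + v z ^ r))) with hgg
  have hggm : AEMeasurable gg (volume.restrict S) := hIS.aemeasurable.ennreal_ofReal
  have hC : ∫⁻ z in S, gg z ≠ ⊤ := (Integrable.lintegral_lt_top hIS).ne
  set C := ∫⁻ z in S, gg z with hCdef
  -- The first entry is for Domar; the second gives `r * log lam ≥ 1`, so a factor `lam` in `v` adds
  -- at least 1 to `log (v ^ r)`.
  set lam := max (2 * K) (Real.exp (1 / r)) with hlamdef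
  have hlam : 2 * K ≤ lam := le_max_left _ _
  have hlam0 : 0 < lam := by linarith
  have hlam1 : 1 ≤ lam := by linarith
  have hlog : 1 ≤ r * Real.log lam := by
    have : 1 / r ≤ Real.log lam :=
      (Real.le_log_iff_exp_le hlam0).2 (le_max_right _ _)
    rw [div_le_iff₀ hr] at this
    linarith
  have hp0 : (0 : ℝ) < p := by exact_mod_cast (by omega : 0 < p)
  have hq0 : (0 : ℝ) < q := by exact_mod_cast (by omega : 0 < q)
  have hφ0 : ∀ t : ℝ, 0 < t → 0 < φ t := fun t ht =>
    lt_of_le_of_lt (hmaps (mem_Ici.2 le_rfl)) (hmono (mem_Ici.2 le_rfl) (mem_Ici.2 ht.le) ht)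
  have hφi : ∀ i : ℕ, 0 < φ ((i : ℝ) + 2) := fun i => hφ0 _ (by positivity)
  -- The weights for the estimate in the second variable.
  set f : ℕ → ℝ := fun i => (φ ((i : ℝ) + 2) ^ (1 / (q : ℝ)))⁻¹ with hf
  have hf0 : ∀ i, 0 < f i := fun i => by have := hφi i; positivity
  have hfanti : Antitone f := fun i j hij => by
    have h1 : (i : ℝ) ≤ j := by exact_mod_cast hij
    have h2 : φ ((i : ℝ) + 2) ≤ φ ((j : ℝ) + 2) :=
      hmono.monotoneOn (mem_Ici.2 (by positivity)) (mem_Ici.2 (by positivity)) (by linarith)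
    have := hφi i
    simp only [hf]
    gcongr
  have hfq : ∀ i, (f i ^ q)⁻¹ = φ ((i : ℝ) + 2) := fun i => by
    simp only [hf]
    rw [inv_pow, inv_inv, one_div, Real.rpow_inv_natCast_pow (hφi i).le (by omega)]
  have hsf : Summable fun j : ℕ => ((j : ℝ) + 1) ^ ((q : ℝ) / p) * f j ^ ((q : ℝ) / p) := by
    refine hs.congr fun j => ?_
    simp only [hf]
    rw [Real.inv_rpow (Real.rpow_nonneg (hφi j).le _), ← Real.rpow_mul (hφi j).le, div_eq_mul_inv]
    congr 3
    field_simp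
  obtain ⟨hfs, hFs⟩ := summable_tail_rpow (a := (q : ℝ) / p) (by positivity)
    ((div_le_one hp0).2 (by exact_mod_cast hqp)) hfanti (fun i => (hf0 i).le) hsf
  set F : ℕ → ℝ := fun k => ∑' i, f (k + i) with hF
  have hF0 : ∀ k, 0 < F k := fun k =>
    Summable.tsum_pos (by simpa only [add_comm] using (summable_nat_add_iff k).2 hfs)
      (fun i => (hf0 _).le) 0 (hf0 _)
  -- The weights for the estimate in the first variable.
  set c := unitBallVolume (q + 1) * δ ^ (q + 1) with hc
  have hc0 : 0 < c := by have := unitBallVolume_pos (q + 1); positivity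
  set d := 2 * lam ^ 2 with hd
  have hd0 : 0 < d := by positivity
  set f' : ℕ → ℝ := fun k => (d / c) ^ (1 / (p : ℝ)) * F k ^ ((q : ℝ) / p) with hf'
  have hf'0 : ∀ k, 0 < f' k := fun k => by have := hF0 k; positivity
  have hf's : Summable f' := hFs.mul_left _
  -- This is exactly the lower bound that Domar's estimate in y gives for the inner integral.
  have hf'p : ∀ k, (f' k ^ p)⁻¹ = c / (d * F k ^ q) := fun k => by
    have h1 : ((d / c) ^ (1 / (p : ℝ))) ^ p = d / c := by
      rw [one_div, Real.rpow_inv_natCast_pow (by positivity) (by omega)]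
    have h2 : (F k ^ ((q : ℝ) / p)) ^ p = F k ^ q := by
      rw [← Real.rpow_natCast, ← Real.rpow_mul (hF0 k).le, div_mul_cancel₀ _ hp0.ne',
        Real.rpow_natCast]
    simp only [hf']
    rw [mul_pow, h1, h2]
    have := (hF0 k).ne'
    field_simp
  -- The tails of `f'` tend to 0. The choice of `k` does not involve the point `z`, so the resulting
  -- bound is uniform.
  obtain ⟨k, hk⟩ : ∃ k : ℕ, d * (∑' i, f' (k + i)) ^ p * C.toReal <
      unitBallVolume (p + 1) * δ ^ (p + 1) := by
    have ht : Filter.Tendsto (fun k : ℕ => d * (∑' i, f' (k + i)) ^ p * C.toReal) Filter.atTop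
        (nhds (d * 0 ^ p * C.toReal)) := by
      refine ((Filter.Tendsto.pow ?_ p).const_mul d).mul_const _
      simpa only [add_comm] using tendsto_sum_nat_add f'
    rw [zero_pow (by omega), mul_zero, zero_mul] at ht
    have := unitBallVolume_pos (p + 1)
    exact (ht.eventually (gt_mem_nhds (by positivity))).exists
  refine ⟨δ, hδ0, lam ^ 3 * lam ^ (k + 1), fun z hz => ?_⟩
  obtain ⟨x, y, rfl⟩ := exists_euclPair_eq z
  by_contra hcon
  rw [not_le] at hcon
  have hsub : ∀ x' ∈ Metric.closedBall x (2 * δ), ∀ y' ∈ Metric.closedBall y (2 * δ),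
      euclPair x' y' ∈ S := fun x' hx' y' hy' => by
    have h1 := Metric.mem_closedBall.1 hx'
    have h2 := Metric.mem_closedBall.1 hy'
    have h3 := dist_euclPair_le x' x y' y
    have h4 := Metric.mem_ball.1 hz
    have h5 := dist_triangle (euclPair x' y') (euclPair x y) z₀
    exact Metric.mem_closedBall.2 (by linarith)
  -- Taking `T = lam ^ 2` yields the shift `i + 2` found in the weights.
  have hlogv : ∀ z, ∀ i : ℕ, lam ^ 2 * lam ^ i < v z →
      ENNReal.ofReal (f i ^ q)⁻¹ ≤ gg z := fun z i hi => by
    rw [hfq]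
    refine ENNReal.ofReal_le_ofReal ?_
    have h1 : ((i : ℝ) + 2) ≤ Real.log (1 + v z ^ r) := by
      have h2 : lam ^ (i + 2) ≤ v z := by rw [pow_add]; linarith
      have h3 : (lam ^ (i + 2)) ^ r ≤ 1 + v z ^ r := by
        have := Real.rpow_le_rpow (by positivity) h2 hr.le
        linarith
      have h4 := Real.log_le_log (by positivity) h3
      rw [Real.log_rpow (by positivity), Real.log_pow] at h4
      push_cast at h4
      have h5 : (0 : ℝ) ≤ i + 2 := by positivity
      nlinarith
    exact hmono.monotoneOn (mem_Ici.2 (by positivity))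
      (mem_Ici.2 (le_trans (by positivity) h1)) h1
  -- One more factor `lam`, because Domar's estimate in y starts from a value above `T * lam ^ (j +
  -- 1)`.
  have hin : ∀ x' ∈ Metric.closedBall x δ, ∀ j : ℕ, lam ^ 3 * lam ^ j < v (euclPair x' y) →
      ENNReal.ofReal (f' j ^ p)⁻¹ ≤ ∫⁻ y' in Metric.closedBall y δ, gg (euclPair x' y') := by
    intro x' hx' j hj
    have hx'' : x' ∈ Metric.closedBall x (2 * δ) :=
      Metric.closedBall_subset_closedBall (by linarith) hx'
    have h1 := (hb x').ofReal_le_mul_lintegral (T := lam ^ 2) hK hlam (by positivity)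
      (fun _ => hv0 _) (hb' x') hδ0 (fun y' hy' => hRΩ (hsub x' hx'' y' hy')) hf0 hfs
      (g := fun y' => gg (euclPair x' y')) (fun y' _ i hi => hlogv _ i hi) (k := j) (y := y)
      (lt_of_le_of_lt (le_of_eq (by ring)) hj)
    have hden : 0 < d * F j ^ q := by have := hF0 j; positivity
    rw [hf'p, ENNReal.ofReal_div_of_pos hden]
    exact ENNReal.div_le_of_le_mul' h1
  have hout := (ha y).ofReal_le_mul_lintegral (T := lam ^ 3) hK hlam (by positivity)
    (fun _ => hv0 _) (ha' y) hδ0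
    (fun x' hx' => hRΩ (hsub x' hx' y (Metric.mem_closedBall_self (by positivity)))) hf'0 hf's
    hin hcon
  have hfub : ∫⁻ x' in Metric.closedBall x δ, ∫⁻ y' in Metric.closedBall y δ,
      gg (euclPair x' y') ≤ C :=
    lintegral_lintegral_euclPair_le Metric.isClosed_closedBall.measurableSet hggm
      fun w hw => hsub w.1 (Metric.closedBall_subset_closedBall (by linarith) hw.1) w.2
        (Metric.closedBall_subset_closedBall (by linarith) hw.2)
  have hfin := hout.trans (mul_le_mul_right hfub _)
  have hnn : 0 ≤ d * (∑' i, f' (k + i)) ^ p := by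
    have : 0 ≤ ∑' i, f' (k + i) := tsum_nonneg fun i => (hf'0 _).le
    positivity
  rw [← ENNReal.ofReal_toReal hC, ← ENNReal.ofReal_mul hnn,
    ENNReal.ofReal_le_ofReal_iff (by positivity)] at hfin
  linarith

/-! ### The joint mean value inequality and the conclusion -/

/-- A product of balls of radius `R / 2` lies in the ball of radius `R`; the constant compares their
volumes. Local integrability is needed to return from the lower integral to the Bochner integral. -/
theorem HasMeanValueBound.of_separately {m n : ℕ} {K : ℝ} (hK : 0 ≤ K)
    {Ω : Set (EuclideanSpace ℝ (Fin (m + n)))}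
    {v : EuclideanSpace ℝ (Fin (m + n)) → ℝ} (hv0 : ∀ z, 0 ≤ v z)
    (ha : ∀ y, HasMeanValueBound K {x | euclPair x y ∈ Ω} fun x => v (euclPair x y))
    (hb : ∀ x, HasMeanValueBound K {y | euclPair x y ∈ Ω} fun y => v (euclPair x y))
    (hint : LocallyIntegrableOn v Ω volume) :
    HasMeanValueBound (K ^ 2 * 2 ^ (m + n) * unitBallVolume (m + n) /
      (unitBallVolume m * unitBallVolume n)) Ω v := by
  intro z R hR hD
  obtain ⟨x, y, rfl⟩ := exists_euclPair_eq z
  have hνm := unitBallVolume_pos m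
  have hνn := unitBallVolume_pos n
  have hν := unitBallVolume_pos (m + n)
  have hR2 : 0 < R / 2 := by positivity
  have hsub : ∀ x' ∈ Metric.closedBall x (R / 2), ∀ y' ∈ Metric.closedBall y (R / 2),
      euclPair x' y' ∈ Ω := fun x' hx' y' hy' => by
    refine hD ?_
    have := prod_subset_preimage_euclPair (mk_mem_prod hx' hy')
    rwa [mul_div_cancel₀ _ two_ne_zero] at this
  have hI : IntegrableOn v (Metric.ball (euclPair x y) R) volume :=
    (hint.integrableOn_compact_subset hD (isCompact_closedBall _ _)).mono_set
      Metric.ball_subset_closedBall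
  have hsub' : Metric.ball x (R / 2) ×ˢ Metric.ball y (R / 2) ⊆
      (fun p : EuclideanSpace ℝ (Fin m) × EuclideanSpace ℝ (Fin n) => euclPair p.1 p.2) ⁻¹'
        Metric.ball (euclPair x y) R := by
    rintro ⟨x', y'⟩ ⟨hx, hy⟩
    have h1 := Metric.mem_ball.1 hx
    have h2 := Metric.mem_ball.1 hy
    have h3 := dist_euclPair_le x' x y' y
    exact Metric.mem_ball.2 (by simp only at *; linarith)
  set c := K / (unitBallVolume m * (R / 2) ^ m) with hc
  set d := K / (unitBallVolume n * (R / 2) ^ n) with hd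
  have hc0 : 0 ≤ c := by positivity
  have hd0 : 0 ≤ d := by positivity
  have hmain : ENNReal.ofReal (v (euclPair x y)) ≤
      ENNReal.ofReal (c * d * ∫ z in Metric.ball (euclPair x y) R, v z) := by
    calc ENNReal.ofReal (v (euclPair x y))
        ≤ ENNReal.ofReal c * ∫⁻ x' in Metric.ball x (R / 2),
            ENNReal.ofReal (v (euclPair x' y)) :=
          (ha y).ofReal_le_lintegral hK (fun _ => hv0 _) hR2
            fun x' hx' => hsub x' hx' y (Metric.mem_closedBall_self hR2.le)
      _ ≤ ENNReal.ofReal c * ∫⁻ x' in Metric.ball x (R / 2), ENNReal.ofReal d *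
            ∫⁻ y' in Metric.ball y (R / 2), ENNReal.ofReal (v (euclPair x' y')) := by
          refine mul_le_mul_right ?_ _
          refine lintegral_mono_ae ?_
          filter_upwards [ae_restrict_mem measurableSet_ball] with x' hx'
          exact (hb x').ofReal_le_lintegral hK (fun _ => hv0 _) hR2
            fun y' hy' => hsub x' (Metric.ball_subset_closedBall hx') y' hy'
      _ = ENNReal.ofReal (c * d) * ∫⁻ x' in Metric.ball x (R / 2),
            ∫⁻ y' in Metric.ball y (R / 2), ENNReal.ofReal (v (euclPair x' y')) := by
          rw [lintegral_const_mul' _ _ ENNReal.ofReal_ne_top, ENNReal.ofReal_mul hc0, mul_assoc]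
      _ ≤ ENNReal.ofReal (c * d) * ∫⁻ z in Metric.ball (euclPair x y) R,
            ENNReal.ofReal (v z) := by
          gcongr
          exact lintegral_lintegral_euclPair_le (h := fun z => ENNReal.ofReal (v z))
            measurableSet_ball hI.aemeasurable.ennreal_ofReal hsub'
      _ = _ := by
          rw [ENNReal.ofReal_mul (mul_nonneg hc0 hd0),
            ofReal_integral_eq_lintegral_ofReal hI (Filter.Eventually.of_forall hv0)]
  have h0 : 0 ≤ ∫ z in Metric.ball (euclPair x y) R, v z := integral_nonneg hv0
  rw [ENNReal.ofReal_le_ofReal_iff (by positivity)] at hmain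
  refine hmain.trans (le_of_eq ?_)
  congr 1
  rw [hc, hd, pow_add, pow_add, div_pow, div_pow]
  field_simp

theorem locallyIntegrableOn_of_locally_bounded {N : ℕ} {Ω : Set (EuclideanSpace ℝ (Fin N))}
    (hΩo : IsOpen Ω) {v : EuclideanSpace ℝ (Fin N) → ℝ} (hv0 : ∀ z, 0 ≤ v z)
    (hm : AEMeasurable v (volume.restrict Ω))
    (hbd : ∀ z₀ ∈ Ω, ∃ δ > 0, ∃ B, ∀ z ∈ Metric.ball z₀ δ, v z ≤ B) :
    LocallyIntegrableOn v Ω volume := fun z₀ hz₀ => by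
  obtain ⟨δ, hδ, B, hB⟩ := hbd z₀ hz₀
  obtain ⟨R, hR, hRΩ⟩ := Metric.isOpen_iff.1 hΩo z₀ hz₀
  refine ⟨Metric.ball z₀ (min δ R),
    mem_nhdsWithin_of_mem_nhds (Metric.ball_mem_nhds _ (lt_min hδ hR)), ?_⟩
  have hsub : Metric.ball z₀ (min δ R) ⊆ Ω :=
    (Metric.ball_subset_ball (min_le_right _ _)).trans hRΩ
  have hfin : IsFiniteMeasure (volume.restrict (Metric.ball z₀ (min δ R))) :=
    ⟨by simpa using measure_ball_lt_top⟩
  refine Integrable.of_bound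
    (hm.mono_measure (Measure.restrict_mono hsub le_rfl)).aestronglyMeasurable B ?_
  filter_upwards [ae_restrict_mem measurableSet_ball] with z hz
  rw [Real.norm_of_nonneg (hv0 z)]
  exact hB z (Metric.ball_subset_ball (min_le_left _ _) hz)

theorem corollary4p5 {m n : ℕ} (hn : 2 ≤ n) (hnm : n ≤ m) (K : ℝ) (hK : 1 ≤ K)
    (Ω : Set (EuclideanSpace ℝ (Fin (m + n)))) (hΩo : IsOpen Ω) (hΩc : IsConnected Ω)
    (u : EuclideanSpace ℝ (Fin (m + n)) → EReal) (hu : ∀ z ∈ Ω, u z < ⊤)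
    (hmeas : NullMeasurable u (volume.restrict Ω))
    (ha : ∀ y : EuclideanSpace ℝ (Fin n),
      IsQuasiNearlySubharmonicWith K {x : EuclideanSpace ℝ (Fin m) | euclPair x y ∈ Ω}
        (fun x => u (euclPair x y)))
    (hb : ∀ x : EuclideanSpace ℝ (Fin m),
      IsQuasiNearlySubharmonicWith K {y : EuclideanSpace ℝ (Fin n) | euclPair x y ∈ Ω}
        (fun y => u (euclPair x y)))
    (hc : ∃ φ : ℝ → ℝ,
      StrictMonoOn φ (Ici 0) ∧ MapsTo φ (Ici 0) (Ici 0) ∧ SurjOn φ (Ici 0) (Ici 0) ∧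
      (∃ s₀ : ℕ, IntegrableOn
        (fun s : ℝ => s ^ (((n : ℝ) - 1) / ((m : ℝ) - 1)) /
          φ (s - (s₀ : ℝ)) ^ (1 / ((m : ℝ) - 1)))
        (Ioi ((s₀ : ℝ) + 1)) volume) ∧
      (∃ r : ℝ, 0 < r ∧
        LocallyIntegrableOn (fun z => φ (Real.log (1 + posPartReal (u z) ^ r))) Ω volume)) :
    IsQuasiNearlySubharmonic Ω u := by
  obtain ⟨φ, hmono, hmaps, -, ⟨s₀, hs₀⟩, r, hr, hint⟩ := hc
  obtain ⟨q, rfl⟩ : ∃ q, n = q + 1 := ⟨n - 1, by omega⟩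
  obtain ⟨p, rfl⟩ : ∃ p, m = p + 1 := ⟨m - 1, by omega⟩
  simp only [Nat.cast_add, Nat.cast_one, add_sub_cancel_right] at hs₀
  have hs := summable_of_integrableOn_weight hmono hmaps (a := (q : ℝ) / p) (b := 1 / (p : ℝ))
    (by positivity) (by positivity) hs₀
  have hv0 : ∀ z, 0 ≤ posPartReal (u z) := fun z => posPartReal_nonneg _
  have hvm : AEMeasurable (fun z => posPartReal (u z)) (volume.restrict Ω) :=
    NullMeasurable.aemeasurable (measurable_posPartReal.comp_nullMeasurable hmeas)
  have hli : LocallyIntegrableOn (fun z => posPartReal (u z)) Ω volume :=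
    locallyIntegrableOn_of_locally_bounded hΩo hv0 hvm fun z₀ hz₀ =>
      exists_ball_bound_of_separately (by omega) (by omega) hK hΩo hv0
        (fun y => (ha y).hasMeanValueBound) (fun y => (ha y).locallyIntegrableOn_posPart)
        (fun x => (hb x).hasMeanValueBound) (fun x => (hb x).locallyIntegrableOn_posPart)
        hmono hmaps hs hr hint hz₀
  have hliM : ∀ M : ℝ, 0 ≤ M → LocallyIntegrableOn (fun z => truncShift M (u z)) Ω volume := by
    intro M hM
    have hconst : LocallyIntegrableOn (fun _ : EuclideanSpace ℝ (Fin (p + 1 + (q + 1))) => M)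
      Ω volume := (locallyIntegrable_const M).locallyIntegrableOn Ω
    have hm : AEMeasurable (fun z => truncShift M (u z)) (volume.restrict Ω) :=
      NullMeasurable.aemeasurable ((measurable_truncShift M).comp_nullMeasurable hmeas)
    intro z hz
    obtain ⟨U, hU, hI⟩ := (hli.add hconst) z hz
    refine ⟨U ∩ Ω, Filter.inter_mem hU self_mem_nhdsWithin,
      Integrable.mono' (hI.mono_set inter_subset_left)
        (hm.mono_measure (Measure.restrict_mono inter_subset_right le_rfl)).aestronglyMeasurable
        (Filter.Eventually.of_forall fun z => ?_)⟩
    rw [Real.norm_of_nonneg (truncShift_nonneg hM _)]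
    exact truncShift_le hM _
  set K' := K ^ 2 * 2 ^ (p + 1 + (q + 1)) * unitBallVolume (p + 1 + (q + 1)) /
    (unitBallVolume (p + 1) * unitBallVolume (q + 1)) with hK'
  -- `K'` does not depend on `M`; the maximum with 1 meets the requirement that the constant be at
  -- least 1.
  refine ⟨max 1 K', le_max_left _ _, hu, hmeas, hli, fun z R hR hD M hM => ?_⟩
  have hmv := HasMeanValueBound.of_separately (v := fun z => truncShift M (u z)) (by linarith)
    (fun z => truncShift_nonneg hM _) (fun y x R hR hD => (ha y).mean_value x R hR hD M hM)
    (fun x y R hR hD => (hb x).mean_value y R hR hD M hM) (hliM M hM) z R hR hD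
  refine hmv.trans ?_
  have hν := unitBallVolume_pos (p + 1 + (q + 1))
  refine mul_le_mul_of_nonneg_right ?_ (integral_nonneg fun z => truncShift_nonneg hM _)
  change K' / _ ≤ max 1 K' / (unitBallVolume _ * _)
  gcongr
  exact le_max_right _ _
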